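/- Let $I=(0,1)$, let $g>0$ be a constant, and let $\tilde u,H\in L^\infty(I)$ be real-valued with $\operatorname{ess\,inf}_I H>0$. Consider the bounded operator $A_0$ on the complex space $L^2(I)^2$ given by $$A_0(\phi_1,\phi_2)=\Bigl(\tilde u\,\phi_1+H\phi_2,\ \ g\int_0^1\phi_1\,\mathrm d\lambda+\tilde u\,\phi_2\Bigr).$$ Let $\tilde u[I]$ denote the essential range of $\tilde u$, i.e. the set of $c\in\mathbb R$ such that for every $\varepsilon>0$ the set $\{\lambda\in I:|\tilde u(\lambda)-c|<\varepsilon\}$ has non-zero Lebesgue measure. For a bounded operator $A$, let the discrete spectrum $\sigma_d(A)$ be the set of $c\in\mathbb C$ for which $A-c\mathbf I$ is Fredholm but not invertible, and let the essential spectrum $\sigma_e(A)$ be the set of $c\in\mathbb C$ for which $A-c\mathbf I$ is not Fredholm. Then $$\sigma_d(A_0)=\Bigl\{c\in\mathbb C\setminus\tilde u[I]:\int_0^1\frac{gH}{(c-\tilde u)^2}\,\mathrm d\lambda=1\Bigr\},\qquad \sigma_e(A_0)=\tilde u[I].$$ In particular, if $\tilde u$ is continuous on $\bar I=[0,1]$,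 both equalities hold with $\tilde u[I]$ replaced by the image $\tilde u(\bar I)$. -/

import Mathlib

open MeasureTheory Set
open scoped ENNReal

noncomputable section

namespace HydrostaticEuler

/-- Lebesgue measure on the interval `I = (0, 1)`. -/
abbrev μI : Measure ℝ := volume.restrict (Ioo (0 : ℝ) 1)

/-- The complex Hilbert space `L²(I)`. -/
abbrev L2 : Type := Lp ℂ 2 μI

/-- A real function in `L^∞(I)`, viewed as an element of the complex space `L^∞(I)`. -/
def toLinf (f : ℝ → ℝ) (hf : MemLp f ∞ μI) : Lp ℂ ∞ μI :=
  (MemLp.ofReal (K := ℂ) hf).toLp (fun x => (f x : ℂ))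

/-- The bounded operator `φ ↦ f φ` of multiplication by `f ∈ L^∞(I)` on `L²(I)`. -/
def mulOp (f : ℝ → ℝ) (hf : MemLp f ∞ μI) : L2 →L[ℂ] L2 :=
  (ContinuousLinearMap.mul ℂ ℂ).holderL μI ∞ 2 2 (toLinf f hf)

/-- The bounded linear functional `φ ↦ ∫₀¹ φ dλ` on `L²(I)`. -/
def integralOp : L2 →L[ℂ] ℂ :=
  (ContinuousLinearMap.mul ℂ ℂ).lpPairing μI 2 2 (Lp.const 2 μI (1 : ℂ))

/-- The operator `A₀ (φ₁, φ₂) = (ũ φ₁ + H φ₂, g ∫₀¹ φ₁ dλ + ũ φ₂)` on `L²(I)²`.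
(The norm of the product type is equivalent to the Hilbert norm of `L²(I)²`.) -/
def A0 (g : ℝ) (u H : ℝ → ℝ) (hu : MemLp u ∞ μI) (hH : MemLp H ∞ μI) :
    (L2 × L2) →L[ℂ] (L2 × L2) :=
  ((mulOp u hu).comp (ContinuousLinearMap.fst ℂ L2 L2) +
      (mulOp H hH).comp (ContinuousLinearMap.snd ℂ L2 L2)).prod
    ((g : ℂ) • ((Lp.constL 2 μI ℂ : ℂ →L[ℂ] L2).comp
        (integralOp.comp (ContinuousLinearMap.fst ℂ L2 L2))) +
      (mulOp u hu).comp (ContinuousLinearMap.snd ℂ L2 L2))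

/-- The essential range of `u` on `I`. -/
def essRange (u : ℝ → ℝ) : Set ℝ :=
  {c | ∀ ε > 0, μI {x | |u x - c| < ε} ≠ 0}

/-- The discrete spectrum: `A - c` is not invertible, but Fredholm. -/
def discreteSpectrum {E : Type*} [NormedAddCommGroup E] [NormedSpace ℂ E] (A : E →L[ℂ] E) :
    Set ℂ :=
  {c | ¬ IsUnit (A - c • ContinuousLinearMap.id ℂ E) ∧
    (A - c • ContinuousLinearMap.id ℂ E).IsFredholm}

/-- The essential spectrum: `A - c` is not Fredholm. -/
def essentialSpectrum {E : Type*} [NormedAddCommGroup E] [NormedSpace ℂ E] (A : E →L[ℂ] E) :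
    Set ℂ :=
  {c | ¬ (A - c • ContinuousLinearMap.id ℂ E).IsFredholm}

theorem mulOp_ae (f : ℝ → ℝ) (hf : MemLp f ∞ μI) (φ : L2) :
    mulOp f hf φ =ᵐ[μI] fun x => (f x : ℂ) * φ x := by
  have h1 := (ContinuousLinearMap.mul ℂ ℂ).coeFn_holder (r := 2) (toLinf f hf) φ
  have h2 := MemLp.coeFn_toLp (MemLp.ofReal (K := ℂ) hf)
  filter_upwards [h1, h2] with x hx1 hx2
  change ((ContinuousLinearMap.mul ℂ ℂ).holder 2 (toLinf f hf) φ) x = _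
  rw [hx1]
  simp only [ContinuousLinearMap.mul_apply']
  congr 1

theorem integralOp_apply (φ : L2) : integralOp φ = ∫ x in Ioo (0 : ℝ) 1, φ x := by
  rw [integralOp, ContinuousLinearMap.lpPairing_eq_integral]
  refine integral_congr_ae ?_
  filter_upwards [Lp.coeFn_const 2 μI (1 : ℂ)] with x hx
  simp only [ContinuousLinearMap.mul_apply', hx, Function.const_apply, one_mul]

theorem A0_fst_ae (g : ℝ) (u H : ℝ → ℝ) (hu : MemLp u ∞ μI) (hH : MemLp H ∞ μI) (φ : L2 × L2) :
    (A0 g u H hu hH φ).1 =ᵐ[μI] fun x => (u x : ℂ) * φ.1 x + (H x : ℂ) * φ.2 x := by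
  have h := Lp.coeFn_add (mulOp u hu φ.1) (mulOp H hH φ.2)
  filter_upwards [h, mulOp_ae u hu φ.1, mulOp_ae H hH φ.2] with x h0 h1 h2
  change (mulOp u hu φ.1 + mulOp H hH φ.2 : L2) x = _
  rw [h0, Pi.add_apply, h1, h2]

theorem A0_snd_ae (g : ℝ) (u H : ℝ → ℝ) (hu : MemLp u ∞ μI) (hH : MemLp H ∞ μI) (φ : L2 × L2) :
    (A0 g u H hu hH φ).2 =ᵐ[μI]
      fun x => (g : ℂ) * (∫ y in Ioo (0 : ℝ) 1, φ.1 y) + (u x : ℂ) * φ.2 x := by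
  have h := Lp.coeFn_add ((g : ℂ) • Lp.const 2 μI (integralOp φ.1)) (mulOp u hu φ.2)
  filter_upwards [h, mulOp_ae u hu φ.2, Lp.coeFn_smul (g : ℂ) (Lp.const 2 μI (integralOp φ.1)),
    Lp.coeFn_const 2 μI (integralOp φ.1)] with x h0 h1 h2 h3
  change ((g : ℂ) • Lp.const 2 μI (integralOp φ.1) + mulOp u hu φ.2 : L2) x = _
  rw [h0, Pi.add_apply, h1, h2, Pi.smul_apply, h3, ← integralOp_apply]
  simp

end HydrostaticEuler

end

/-! Write `A0 - c` as a triangular operator `(x, y) ↦ (U x + H y, U y)`, with `U` multiplication by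
`u - c`, plus the rank-one term `x ↦ (0, ℓ x.1 • e)`, where `ℓ` is the integral and `e` the constant
`g`. Off the essential range `U` has a bounded inverse `W`, hence so has the triangular part. A
rank-one perturbation of an invertible operator is Fredholm, and it is invertible exactly when the
scalar `1 - ℓ (W (H (W e)))` is nonzero; here `ℓ (W (H (W e)))` is the integral of `g H / (c - u)²`
(`isUnit_A0_sub_iff`). On the essential range, a Fredholm operator would be bounded below on a
subspace of finite codimension. Functions supported where `u` is close to `c` form an
infinite-dimensional space, so one of them contradicts this bound (`not_isFredholm_A0_sub`). -/

namespace HydrostaticEuler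

/-! ### Rank-one perturbations of triangular block operators -/

section BlockOperator

variable {E : Type*} [NormedAddCommGroup E] [NormedSpace ℂ E]

/-- The block operator `(x, y) ↦ (U x + H y, ℓ x • e + U y)`. -/
noncomputable def blockOp (U H : E →L[ℂ] E) (ℓ : E →L[ℂ] ℂ) (e : E) : (E × E) →L[ℂ] (E × E) :=
  (U.comp (ContinuousLinearMap.fst ℂ E E) + H.comp (ContinuousLinearMap.snd ℂ E E)).prod
    ((ℓ.comp (ContinuousLinearMap.fst ℂ E E)).smulRight e +
      U.comp (ContinuousLinearMap.snd ℂ E E))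

@[simp]
theorem blockOp_apply (U H : E →L[ℂ] E) (ℓ : E →L[ℂ] ℂ) (e : E) (x : E × E) :
    blockOp U H ℓ e x = (U x.1 + H x.2, ℓ x.1 • e + U x.2) := rfl

/-- The inverse of `(x, y) ↦ (U x + H y, U y)`, where `W` is the inverse of `U`. -/
noncomputable def triangularInv (W H : E →L[ℂ] E) : (E × E) →L[ℂ] (E × E) :=
  (W.comp (ContinuousLinearMap.fst ℂ E E) -
      (W.comp (H.comp W)).comp (ContinuousLinearMap.snd ℂ E E)).prod
    (W.comp (ContinuousLinearMap.snd ℂ E E))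

@[simp]
theorem triangularInv_apply (W H : E →L[ℂ] E) (x : E × E) :
    triangularInv W H x = (W x.1 - W (H (W x.2)), W x.2) := rfl

variable {U W H : E →L[ℂ] E} {ℓ : E →L[ℂ] ℂ} {e : E}

theorem triangularInv_blockOp (hWU : ∀ x, W (U x) = x) (x : E × E) :
    triangularInv W H (blockOp U H ℓ e x) = x + ℓ x.1 • triangularInv W H (0, e) := by
  ext <;> simp [hWU, add_comm, sub_eq_add_neg]

theorem blockOp_triangularInv (hUW : ∀ x, U (W x) = x) (x : E × E) :
    blockOp U H ℓ e (triangularInv W H x) =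
      x + ℓ (triangularInv W H x).1 • ((0, e) : E × E) := by
  ext <;> simp [hUW, add_comm]

theorem hasFiniteRange_of_eq_smul {F : Type*} [AddCommGroup F] [Module ℂ F] (T : F →ₗ[ℂ] F)
    (k : F →ₗ[ℂ] ℂ) (v : F) (h : ∀ x, T x = k x • v) : T.HasFiniteRange := by
  have : T = (LinearMap.toSpanSingleton ℂ F v).comp k := by
    ext x; simp [h]
  rw [this]
  exact LinearMap.HasFiniteRange.of_isNoetherian_rng.comp_left _

theorem blockOp_isFredholm (hUW : ∀ x, U (W x) = x) (hWU : ∀ x, W (U x) = x) :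
    (blockOp U H ℓ e).IsFredholm := by
  refine ContinuousLinearMap.IsFredholm.of_isQuasiInverse (v := triangularInv W H) ⟨?_, ?_⟩
  · refine LinearMap.FiniteRangeSetoid.equiv_iff_hasFiniteRange.2
      (hasFiniteRange_of_eq_smul _
        (ℓ.comp (ContinuousLinearMap.fst ℂ E E)).toLinearMap (triangularInv W H (0, e)) fun x => ?_)
    have := triangularInv_blockOp (H := H) (ℓ := ℓ) (e := e) hWU x
    simp only [LinearMap.sub_apply, LinearMap.comp_apply, ContinuousLinearMap.coe_coe, this]
    simp
  · refine LinearMap.FiniteRangeSetoid.equiv_iff_hasFiniteRange.2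
      (hasFiniteRange_of_eq_smul _
        ((ℓ.comp (ContinuousLinearMap.fst ℂ E E)).comp (triangularInv W H)).toLinearMap
        (0, e) fun x => ?_)
    have := blockOp_triangularInv (H := H) (ℓ := ℓ) (e := e) hUW x
    simp only [LinearMap.sub_apply, LinearMap.comp_apply, ContinuousLinearMap.coe_coe, this]
    simp

/-- The vector `triangularInv W H (0, e)` lies in the kernel: its first component is `-W (H (W e))`,
on which `ℓ` is `-1`, so the rank-one term cancels `(0, e)`. -/
theorem not_isUnit_blockOp (hUW : ∀ x, U (W x) = x) (h : ℓ (W (H (W e))) = 1) :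
    ¬ IsUnit (blockOp U H ℓ e) := by
  intro hu
  have hz : blockOp U H ℓ e (triangularInv W H (0, e)) = 0 := by
    rw [blockOp_triangularInv hUW]
    ext <;> simp [h]
  obtain ⟨S, hS⟩ := hu.exists_left_inv
  have h0 : triangularInv W H (0, e) = 0 := by
    have := congrArg (fun T : (E × E) →L[ℂ] (E × E) => T (triangularInv W H (0, e))) hS
    simpa only [mul_apply_eq_comp, hz, map_zero, one_apply_eq_self,
      eq_comm] using this
  have h1 : W (H (W e)) = 0 := by simpa using congrArg Prod.fst h0
  rw [h1, map_zero] at h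
  exact zero_ne_one h

theorem isUnit_blockOp (hUW : ∀ x, U (W x) = x) (hWU : ∀ x, W (U x) = x)
    (h : ℓ (W (H (W e))) ≠ 1) : IsUnit (blockOp U H ℓ e) := by
  have hd : 1 - ℓ (W (H (W e))) ≠ 0 := sub_ne_zero.2 (Ne.symm h)
  set N := triangularInv W H with hN
  set k : (E × E) →L[ℂ] ℂ := ℓ.comp (ContinuousLinearMap.fst ℂ E E) with hk
  have hkN : k (N (0, e)) = - ℓ (W (H (W e))) := by simp [hk, hN]
  set d := 1 - ℓ (W (H (W e))) with hdd
  -- Sherman–Morrison formula, with denominator `d = 1 + k (N (0, e))`.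
  set S : (E × E) →L[ℂ] (E × E) := N - (d⁻¹ • k.comp N).smulRight (N (0, e)) with hS
  have hSa : ∀ x, S x = N x - (d⁻¹ * k (N x)) • N (0, e) := fun x => by simp [hS]
  have e1 : blockOp U H ℓ e * S = 1 := by
    refine ContinuousLinearMap.ext fun x => ?_
    have hB : ∀ x, blockOp U H ℓ e (N x) = x + k (N x) • ((0, e) : E × E) :=
      blockOp_triangularInv hUW
    rw [mul_apply_eq_comp, hSa, map_sub, map_smul, hB, hB, hkN,
      one_apply_eq_self, smul_add, smul_smul, add_sub_assoc, ← add_smul, ← sub_smul]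
    have : k (N x) - (d⁻¹ * k (N x) + d⁻¹ * k (N x) * -ℓ (W (H (W e)))) = 0 := by
      have : d⁻¹ * k (N x) + d⁻¹ * k (N x) * -ℓ (W (H (W e))) = (d⁻¹ * d) * k (N x) := by
        rw [hdd]; ring
      rw [this, inv_mul_cancel₀ hd]; ring
    rw [this, zero_smul, add_zero]
  have e2 : S * blockOp U H ℓ e = 1 := by
    refine ContinuousLinearMap.ext fun x => ?_
    have hB : ∀ x, N (blockOp U H ℓ e x) = x + k x • N (0, e) := triangularInv_blockOp hWU
    rw [mul_apply_eq_comp, hSa, hB, map_add, map_smul, hkN,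
      one_apply_eq_self, add_sub_assoc, ← sub_smul]
    have : k x - d⁻¹ * (k x + k x • -ℓ (W (H (W e)))) = 0 := by
      have : k x + k x • -ℓ (W (H (W e))) = d * k x := by
        rw [hdd, smul_eq_mul]; ring
      rw [this, inv_mul_cancel_left₀ hd, sub_self]
    rw [this, zero_smul, add_zero]
  exact ⟨⟨_, S, e1, e2⟩, rfl⟩

end BlockOperator

/-! ### Fredholm operators and finite codimension -/

theorem exists_ne_zero_map_mem_of_coFG {V E : Type*} [AddCommGroup V] [Module ℂ V]
    [AddCommGroup E] [Module ℂ E] (hV : ¬ Module.Finite ℂ V) (p : V →ₗ[ℂ] E)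
    {S : Submodule ℂ E} (hS : S.CoFG) : ∃ x, x ≠ 0 ∧ p x ∈ S := by
  by_contra! hcon
  refine hV (Module.Finite.of_injective (S.mkQ.comp p) ?_)
  rw [← LinearMap.ker_eq_bot, LinearMap.ker_eq_bot']
  intro x hx
  by_contra hne
  exact hcon x hne (by simpa using hx)

/-- A bounded quasi-inverse `v` satisfies `v ∘ T = id` up to finite rank, hence exactly on a
subspace of finite codimension; there `K = ‖v‖` works. -/
theorem exists_le_norm_of_isFredholm {E : Type*} [NormedAddCommGroup E] [NormedSpace ℂ E]
    {T : E →L[ℂ] E} (hT : T.IsFredholm) :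
    ∃ (S : Submodule ℂ E) (K : ℝ), S.CoFG ∧ 0 ≤ K ∧ ∀ x ∈ S, ‖x‖ ≤ K * ‖T x‖ := by
  obtain ⟨v, hv, -⟩ := hT.exists_isQuasiInverse
  refine ⟨_, ‖v‖, LinearMap.FiniteRangeSetoid.equiv_iff_eqLocus_coFG.1 hv, norm_nonneg _,
    fun x hx => ?_⟩
  have hx' : v (T x) = x := hx
  calc ‖x‖ = ‖v (T x)‖ := by rw [hx']
    _ ≤ _ := v.le_opNorm _

/-- Multiplication by an essentially bounded complex function on `L²(I)`. -/
noncomputable def complexMulOp (f : ℝ → ℂ) (hf : MemLp f ∞ μI) : L2 →L[ℂ] L2 :=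
  (ContinuousLinearMap.mul ℂ ℂ).holderL μI ∞ 2 2 (hf.toLp f)

theorem complexMulOp_ae (f : ℝ → ℂ) (hf : MemLp f ∞ μI) (φ : L2) :
    complexMulOp f hf φ =ᵐ[μI] fun x => f x * φ x := by
  have h1 := (ContinuousLinearMap.mul ℂ ℂ).coeFn_holder (r := 2) (hf.toLp f) φ
  filter_upwards [h1, hf.coeFn_toLp] with x hx1 hx2
  change ((ContinuousLinearMap.mul ℂ ℂ).holder 2 (hf.toLp f) φ) x = _
  rw [hx1, ContinuousLinearMap.mul_apply', hx2]

/-- The operator of multiplication by `u - c`. -/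
noncomputable def shiftedMulOp (u : ℝ → ℝ) (hu : MemLp u ∞ μI) (c : ℂ) : L2 →L[ℂ] L2 :=
  mulOp u hu - c • ContinuousLinearMap.id ℂ L2

theorem shiftedMulOp_ae (u : ℝ → ℝ) (hu : MemLp u ∞ μI) (c : ℂ) (φ : L2) :
    shiftedMulOp u hu c φ =ᵐ[μI] fun x => ((u x : ℂ) - c) * φ x := by
  have h := Lp.coeFn_sub (mulOp u hu φ) (c • φ)
  filter_upwards [h, mulOp_ae u hu φ, Lp.coeFn_smul c φ] with x h0 h1 h2
  change (mulOp u hu φ - c • φ : L2) x = _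
  rw [h0, Pi.sub_apply, h1, h2, Pi.smul_apply, smul_eq_mul, sub_mul]

theorem A0_sub_eq_blockOp (g : ℝ) (u H : ℝ → ℝ) (hu : MemLp u ∞ μI) (hH : MemLp H ∞ μI) (c : ℂ) :
    A0 g u H hu hH - c • ContinuousLinearMap.id ℂ (L2 × L2) =
      blockOp (shiftedMulOp u hu c) (mulOp H hH) integralOp (Lp.const 2 μI (g : ℂ)) := by
  refine ContinuousLinearMap.ext fun x => Prod.ext ?_ ?_
  · change mulOp u hu x.1 + mulOp H hH x.2 - c • x.1 =
      (mulOp u hu x.1 - c • x.1) + mulOp H hH x.2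
    abel
  · change (g : ℂ) • (Lp.constL 2 μI ℂ : ℂ →L[ℂ] L2) (integralOp x.1) + mulOp u hu x.2 - c • x.2 =
      integralOp x.1 • (Lp.constL 2 μI ℂ : ℂ →L[ℂ] L2) (g : ℂ) + (mulOp u hu x.2 - c • x.2)
    rw [← (Lp.constL 2 μI ℂ).map_smul, ← (Lp.constL 2 μI ℂ).map_smul, smul_eq_mul, smul_eq_mul,
      mul_comm, add_sub_assoc]

/-- For non-real `c` the distance to the real axis is a lower bound; for real `c` it is the `ε` that
excludes `c` from the essential range. -/
theorem exists_le_norm_sub_of_notMem_essRange {u : ℝ → ℝ} {c : ℂ}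
    (hc : c ∉ Complex.ofReal '' essRange u) :
    ∃ δ : ℝ, 0 < δ ∧ ∀ᵐ x ∂μI, δ ≤ ‖(u x : ℂ) - c‖ := by
  by_cases him : c.im = 0
  · have hre : c = (c.re : ℂ) := Complex.ext rfl (by simpa using him)
    have h : c.re ∉ essRange u := fun h => hc ⟨_, h, hre.symm⟩
    simp only [essRange, mem_ofPred_eq, not_forall, not_not] at h
    obtain ⟨ε, hε, h0⟩ := h
    refine ⟨ε, hε, ?_⟩
    rw [ae_iff]
    refine Eq.trans (congrArg μI (Set.ext fun x => ?_)) h0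
    simp only [mem_ofPred_eq]
    rw [hre, ← Complex.ofReal_sub, Complex.norm_real, Real.norm_eq_abs, not_le, Complex.ofReal_re]
  · refine ⟨|c.im|, abs_pos.2 him, Filter.Eventually.of_forall fun x => ?_⟩
    simpa using Complex.abs_im_le_norm ((u x : ℂ) - c)

theorem memLp_inv_sub {u : ℝ → ℝ} (hu : MemLp u ∞ μI) {c : ℂ} {δ : ℝ} (hδ : 0 < δ)
    (h : ∀ᵐ x ∂μI, δ ≤ ‖(u x : ℂ) - c‖) : MemLp (fun x => ((u x : ℂ) - c)⁻¹) ∞ μI := by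
  refine memLp_top_of_bound (C := δ⁻¹) ?_ ?_
  · have : AEMeasurable u μI := hu.1.aemeasurable
    have h2 : AEMeasurable (fun x => ((u x : ℂ) - c)⁻¹) μI := by fun_prop
    exact h2.aestronglyMeasurable
  · filter_upwards [h] with x hx
    rw [norm_inv]
    exact inv_anti₀ hδ hx

/-! ### Off the essential range -/

section Resolvent

variable {g : ℝ} {u H : ℝ → ℝ} (hu : MemLp u ∞ μI) (hH : MemLp H ∞ μI) {c : ℂ}

theorem exists_inverse_shiftedMulOp (hc : c ∉ Complex.ofReal '' essRange u) :
    ∃ W : L2 →L[ℂ] L2, (∀ φ, shiftedMulOp u hu c (W φ) = φ) ∧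
      (∀ φ, W (shiftedMulOp u hu c φ) = φ) ∧
      ∀ φ, W φ =ᵐ[μI] fun x => ((u x : ℂ) - c)⁻¹ * φ x := by
  obtain ⟨δ, hδ, h⟩ := exists_le_norm_sub_of_notMem_essRange hc
  have hw := memLp_inv_sub hu hδ h
  have hne : ∀ᵐ x ∂μI, (u x : ℂ) - c ≠ 0 := by
    filter_upwards [h] with x hx
    exact norm_pos_iff.1 (hδ.trans_le hx)
  refine ⟨complexMulOp _ hw, fun φ => Lp.ext ?_, fun φ => Lp.ext ?_, complexMulOp_ae _ hw⟩
  · filter_upwards [shiftedMulOp_ae u hu c (complexMulOp _ hw φ), complexMulOp_ae _ hw φ, hne]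
      with x h1 h2 h3
    rw [h1, h2, mul_inv_cancel_left₀ h3]
  · filter_upwards [complexMulOp_ae _ hw (shiftedMulOp u hu c φ), shiftedMulOp_ae u hu c φ, hne]
      with x h1 h2 h3
    rw [h1, h2, inv_mul_cancel_left₀ h3]

theorem isFredholm_A0_sub (hc : c ∉ Complex.ofReal '' essRange u) :
    (A0 g u H hu hH - c • ContinuousLinearMap.id ℂ (L2 × L2)).IsFredholm := by
  obtain ⟨W, h1, h2, -⟩ := exists_inverse_shiftedMulOp hu hc
  rw [A0_sub_eq_blockOp]
  exact blockOp_isFredholm h1 h2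

theorem isUnit_A0_sub_iff (hc : c ∉ Complex.ofReal '' essRange u) :
    IsUnit (A0 g u H hu hH - c • ContinuousLinearMap.id ℂ (L2 × L2)) ↔
      ∫ x in Ioo (0 : ℝ) 1, ((g * H x : ℝ) : ℂ) / (c - (u x : ℂ)) ^ 2 ≠ 1 := by
  obtain ⟨W, h1, h2, hW⟩ := exists_inverse_shiftedMulOp hu hc
  have hD : integralOp (W (mulOp H hH (W (Lp.const 2 μI (g : ℂ))))) =
      ∫ x in Ioo (0 : ℝ) 1, ((g * H x : ℝ) : ℂ) / (c - (u x : ℂ)) ^ 2 := by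
    rw [integralOp_apply]
    refine integral_congr_ae ?_
    filter_upwards [hW (mulOp H hH (W (Lp.const 2 μI (g : ℂ)))),
      mulOp_ae H hH (W (Lp.const 2 μI (g : ℂ))), hW (Lp.const 2 μI (g : ℂ)),
      Lp.coeFn_const 2 μI (g : ℂ)] with x e1 e2 e3 e4
    rw [e1, e2, e3, e4, Function.const_apply, div_eq_mul_inv, ← neg_sub (u x : ℂ) c, neg_sq,
      ← inv_pow]
    push_cast
    ring
  rw [A0_sub_eq_blockOp, ← hD]
  exact ⟨fun h h' => not_isUnit_blockOp h1 h' h, isUnit_blockOp h1 h2⟩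

end Resolvent

/-! ### On the essential range -/

section EssentialSpectrum

theorem memLp_indicator_polynomial {S : Set ℝ} (hS : MeasurableSet S) (p : Polynomial ℂ) :
    MemLp (S.indicator fun x : ℝ => p.eval (x : ℂ)) 2 μI := by
  have hcont : Continuous fun x : ℝ => p.eval (x : ℂ) := by fun_prop
  obtain ⟨C, hC⟩ := isCompact_Icc.exists_bound_of_continuousOn
    (s := Icc (0 : ℝ) 1) hcont.continuousOn
  refine MemLp.indicator hS (MemLp.of_bound hcont.aestronglyMeasurable C ?_)
  filter_upwards [ae_restrict_mem measurableSet_Ioo] with x hx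
  exact hC x (Ioo_subset_Icc_self hx)

/-- The linear map sending a polynomial to its restriction to `S`, extended by zero. -/
noncomputable def indicatorPolynomial {S : Set ℝ} (hS : MeasurableSet S) :
    Polynomial ℂ →ₗ[ℂ] L2 where
  toFun p := (memLp_indicator_polynomial hS p).toLp _
  map_add' p q := by
    rw [← MemLp.toLp_add]
    refine MemLp.toLp_congr _ _ (Filter.Eventually.of_forall fun x => ?_)
    by_cases hx : x ∈ S <;> simp [hx]
  map_smul' a p := by
    rw [RingHom.id_apply, ← MemLp.toLp_const_smul]
    refine MemLp.toLp_congr _ _ (Filter.Eventually.of_forall fun x => ?_)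
    by_cases hx : x ∈ S <;> simp [hx]

theorem indicatorPolynomial_ae {S : Set ℝ} (hS : MeasurableSet S) (p : Polynomial ℂ) :
    indicatorPolynomial hS p =ᵐ[μI] S.indicator fun x : ℝ => p.eval (x : ℂ) :=
  MemLp.coeFn_toLp (memLp_indicator_polynomial hS p)

/-- The roots of a nonzero polynomial form a null set, so they cannot fill `S`. -/
theorem indicatorPolynomial_ne_zero {S : Set ℝ} (hS : MeasurableSet S) (hS0 : μI S ≠ 0)
    {p : Polynomial ℂ} (hp : p ≠ 0) : indicatorPolynomial hS p ≠ 0 := by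
  intro h0
  refine hS0 ?_
  have hfin : {x : ℝ | p.eval (x : ℂ) = 0}.Finite := by
    refine Set.Finite.preimage Complex.ofReal_injective.injOn
      (s := {z : ℂ | p.eval z = 0}) ?_
    simpa [Polynomial.IsRoot] using Polynomial.finite_setOfPred_isRoot hp
  have hroot : ∀ᵐ x ∂μI, x ∉ {x : ℝ | p.eval (x : ℂ) = 0} :=
    measure_eq_zero_iff_ae_notMem.1 (hfin.measure_zero _)
  have hz : indicatorPolynomial hS p =ᵐ[μI] 0 := by rw [h0]; exact Lp.coeFn_zero _ _ _
  rw [measure_eq_zero_iff_ae_notMem]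
  filter_upwards [hroot, hz, indicatorPolynomial_ae hS p] with x e1 e2 e3 hx
  rw [e3, indicator_of_mem hx] at e2
  exact e1 e2

variable {g : ℝ} {u H : ℝ → ℝ} (hu : MemLp u ∞ μI) (hH : MemLp H ∞ μI)

theorem not_isFredholm_A0_sub {c : ℝ} (hc : c ∈ essRange u) :
    ¬ (A0 g u H hu hH - (c : ℂ) • ContinuousLinearMap.id ℂ (L2 × L2)).IsFredholm := by
  rw [A0_sub_eq_blockOp]
  intro hF
  obtain ⟨E₁, K, hE, hK, hle⟩ := exists_le_norm_of_isFredholm hF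
  -- A measurable representative makes the set `S` below measurable.
  set u' := hu.1.mk u
  have huu : u =ᵐ[μI] u' := hu.1.ae_eq_mk
  have hum : Measurable u' := hu.1.stronglyMeasurable_mk.measurable
  -- Chosen so that `K * ε < 1`, also when `K = 0`.
  set ε : ℝ := (2 * (K + 1))⁻¹ with hε
  have hεpos : 0 < ε := by positivity
  set S : Set ℝ := {x | |u' x - c| < ε} with hSdef
  have hS : MeasurableSet S :=
    measurableSet_lt (by fun_prop) measurable_const
  have hS0 : μI S ≠ 0 := by
    have : μI S = μI {x | |u x - c| < ε} := by
      refine measure_congr ?_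
      filter_upwards [huu] with x hx
      change (|u' x - c| < ε) = (|u x - c| < ε)
      rw [hx]
    rw [this]
    exact hc ε hεpos
  -- Also requiring zero integral costs one more dimension and removes the rank-one term.
  have hS₂ : (E₁ ⊓ (LinearMap.ker
      (integralOp.comp (ContinuousLinearMap.fst ℂ L2 L2)).toLinearMap)).CoFG :=
    hE.inf (Submodule.CoFG.ker _)
  obtain ⟨p, hp, hp1, hp2⟩ := exists_ne_zero_map_mem_of_coFG Polynomial.not_finite
    ((LinearMap.inl ℂ L2 L2).comp (indicatorPolynomial hS)) hS₂
  set φ := indicatorPolynomial hS p with hφ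
  have hφ0 : φ ≠ 0 := indicatorPolynomial_ne_zero hS hS0 hp
  have hint : integralOp φ = 0 := hp2
  have hb := hle _ hp1
  have hT : blockOp (shiftedMulOp u hu c) (mulOp H hH) integralOp (Lp.const 2 μI (g : ℂ))
      (φ, 0) = (shiftedMulOp u hu c φ, 0) := by
    simp [hint]
  have hb' : ‖φ‖ ≤ K * ‖shiftedMulOp u hu c φ‖ := by
    have := hb
    change ‖((φ, 0) : L2 × L2)‖ ≤ K * ‖blockOp _ _ _ _ (φ, 0)‖ at this
    rw [hT] at this
    simpa [Prod.norm_def] using this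
  have hsmall : ‖shiftedMulOp u hu c φ‖ ≤ ε * ‖φ‖ := by
    refine Lp.norm_le_mul_norm_of_ae_le_mul ?_
    filter_upwards [shiftedMulOp_ae u hu c φ, huu, indicatorPolynomial_ae hS p] with x e1 e2 e3
    rw [e1, norm_mul]
    by_cases hx : x ∈ S
    · refine mul_le_mul_of_nonneg_right ?_ (norm_nonneg _)
      rw [← Complex.ofReal_sub, Complex.norm_real, Real.norm_eq_abs, e2]
      exact le_of_lt hx
    · rw [e3, indicator_of_notMem hx]
      simp
  have hpos : 0 < ‖φ‖ := norm_pos_iff.2 hφ0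
  have h1 : ‖φ‖ ≤ K * (ε * ‖φ‖) := hb'.trans (mul_le_mul_of_nonneg_left hsmall hK)
  have h2 : K * ε < 1 := by
    rw [hε, ← div_eq_mul_inv, div_lt_one (by positivity)]
    linarith
  nlinarith

end EssentialSpectrum

theorem essRange_eq_image {u : ℝ → ℝ} (hu : ContinuousOn u (Icc (0 : ℝ) 1)) :
    essRange u = u '' Icc (0 : ℝ) 1 := by
  ext c
  constructor
  · intro hc
    by_contra hcon
    have hopen : IsOpen (u '' Icc (0 : ℝ) 1)ᶜ :=
      (isCompact_Icc.image_of_continuousOn hu).isClosed.isOpen_compl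
    obtain ⟨ε, hε, hball⟩ := Metric.isOpen_iff.1 hopen c hcon
    refine hc ε hε ?_
    rw [Measure.restrict_apply' measurableSet_Ioo]
    convert measure_empty (μ := (volume : Measure ℝ))
    rw [eq_empty_iff_forall_notMem]
    rintro x ⟨hx, hxI⟩
    exact hball (show u x ∈ Metric.ball c ε from hx) ⟨x, Ioo_subset_Icc_self hxI, rfl⟩
  · rintro ⟨x₀, hx₀, rfl⟩ ε hε
    rw [Measure.restrict_apply' measurableSet_Ioo]
    obtain ⟨δ, hδ, h⟩ := Metric.continuousOn_iff.1 hu x₀ hx₀ ε hε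
    have hne : (Metric.ball x₀ δ ∩ Ioo (0 : ℝ) 1).Nonempty := by
      -- Passing to the closure covers the endpoints `0` and `1` too.
      have hcl : x₀ ∈ closure (Ioo (0 : ℝ) 1) := by rwa [closure_Ioo zero_ne_one]
      exact mem_closure_iff.1 hcl _ Metric.isOpen_ball (Metric.mem_ball_self hδ)
    have hpos := (Metric.isOpen_ball.inter isOpen_Ioo).measure_pos volume hne
    refine (hpos.trans_le (measure_mono ?_)).ne'
    rintro x ⟨hx, hxI⟩
    exact ⟨h x (Ioo_subset_Icc_self hxI) hx, hxI⟩

end HydrostaticEuler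

theorem mainTheorem5 (g : ℝ) (hg : 0 < g) (u H : ℝ → ℝ)
    (hu : MemLp u ∞ HydrostaticEuler.μI) (hH : MemLp H ∞ HydrostaticEuler.μI)
    (hHpos : ∃ m : ℝ, 0 < m ∧ ∀ᵐ x ∂HydrostaticEuler.μI, m ≤ H x) :
    (HydrostaticEuler.discreteSpectrum (HydrostaticEuler.A0 g u H hu hH) =
        {c : ℂ | c ∉ Complex.ofReal '' HydrostaticEuler.essRange u ∧
          ∫ x in Ioo (0 : ℝ) 1, ((g * H x : ℝ) : ℂ) / (c - (u x : ℂ)) ^ 2 = 1} ∧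
      HydrostaticEuler.essentialSpectrum (HydrostaticEuler.A0 g u H hu hH) =
        Complex.ofReal '' HydrostaticEuler.essRange u) ∧
    (ContinuousOn u (Icc (0 : ℝ) 1) →
      HydrostaticEuler.discreteSpectrum (HydrostaticEuler.A0 g u H hu hH) =
        {c : ℂ | c ∉ Complex.ofReal '' (u '' Icc (0 : ℝ) 1) ∧
          ∫ x in Ioo (0 : ℝ) 1, ((g * H x : ℝ) : ℂ) / (c - (u x : ℂ)) ^ 2 = 1} ∧
      HydrostaticEuler.essentialSpectrum (HydrostaticEuler.A0 g u H hu hH) =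
        Complex.ofReal '' (u '' Icc (0 : ℝ) 1)) := by
  open HydrostaticEuler in
  have hF : ∀ c : ℂ, (A0 g u H hu hH - c • ContinuousLinearMap.id ℂ (L2 × L2)).IsFredholm ↔
      c ∉ Complex.ofReal '' essRange u := fun c =>
    ⟨by rintro h ⟨r, hr, rfl⟩; exact not_isFredholm_A0_sub hu hH hr h, isFredholm_A0_sub hu hH⟩
  have main : HydrostaticEuler.discreteSpectrum (HydrostaticEuler.A0 g u H hu hH) =
        {c : ℂ | c ∉ Complex.ofReal '' HydrostaticEuler.essRange u ∧
          ∫ x in Ioo (0 : ℝ) 1, ((g * H x : ℝ) : ℂ) / (c - (u x : ℂ)) ^ 2 = 1} ∧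
      HydrostaticEuler.essentialSpectrum (HydrostaticEuler.A0 g u H hu hH) =
        Complex.ofReal '' HydrostaticEuler.essRange u := by
    constructor
    · ext c
      simp only [HydrostaticEuler.discreteSpectrum, mem_ofPred_eq, hF]
      rw [and_comm]
      refine and_congr_right fun hc => ?_
      rw [HydrostaticEuler.isUnit_A0_sub_iff hu hH hc, not_not]
    · ext c
      simp only [HydrostaticEuler.essentialSpectrum, mem_ofPred_eq, hF, not_not]
  exact ⟨main, fun hcont => HydrostaticEuler.essRange_eq_image hcont ▸ main⟩
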